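/- Let $n\ge 0$ be an integer, let $r\in(0,+\infty]$, and let $\mathbb B^n_r=\{z\in\mathbb C^n:\sum_{i=1}^n|z_i|^2<r^2\}$ (so $\mathbb B^n_\infty=\mathbb C^n$). Let $\mathcal O(\mathbb B^n_r)$ be the algebra of holomorphic functions on $\mathbb B^n_r$ with the topology of uniform convergence on compact subsets of $\mathbb B^n_r$. For a multi-index $k=(k_1,\dots,k_n)\in\mathbb Z_{\ge 0}^n$ write $|k|=k_1+\cdots+k_n$, $k!=k_1!\cdots k_n!$ and $z^k=z_1^{k_1}\cdots z_n^{k_n}$. Let $P$ be the vector space of all formal power series $c=\sum_{k} c_k z^k$ with complex coefficients such that $$\|c\|_\rho=\sum_{k\in\mathbb Z_{\ge 0}^n}|c_k|\left(\frac{k!}{|k|!}\right)^{1/2}\rho^{|k|}<\infty\qquad\text{for all }\rho\in(0,r),$$ with the locally convex topology generated by the norms $\|\cdot\|_\rho$, $\rho\in(0,r)$. Then there is a topological isomorphism (a linear bijection, continuous in both directions) $\mathcal O(\mathbb B^n_r)\cong P$. It takes each $f\in\mathcal O(\mathbb B^n_r)$ to its Taylor series at $0$: if $f\mapsto\sum_k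 c_kz^k$, then $\sum_k c_kz^k$ converges unconditionally to $f(z)$ for every $z\in\mathbb B^n_r$. -/

import Mathlib

open scoped ENNReal Nat

noncomputable section

/-- The open ball `{z ∈ ℂⁿ : ∑ |z_i|² < r²}` of radius `r ∈ [0, ∞]`; it is all of `ℂⁿ` when
`r = ∞`. Only the topology and the linear structure of `Fin n → ℂ` are used, not its sup norm. -/
def complexBall (n : ℕ) (r : ℝ≥0∞) : Set (Fin n → ℂ) :=
  {z | ∑ i, ‖z i‖ₑ ^ 2 < r ^ 2}

/-- The algebra `𝒪(U)` of holomorphic functions on a set `U ⊆ ℂⁿ` (used for open `U`), as a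
subalgebra of the continuous functions on `U`. Its topology is the one induced by the compact-open
topology of `C(U, ℂ)`, i.e. the topology of uniform convergence on the compact subsets of `U`. -/
def holomorphicAlgebra {n : ℕ} (U : Set (Fin n → ℂ)) : Subalgebra ℂ C(U, ℂ) where
  carrier := {f | ∃ F : (Fin n → ℂ) → ℂ, DifferentiableOn ℂ F U ∧ ∀ z : U, f z = F z}
  mul_mem' := by
    rintro f g ⟨F, hF, hf⟩ ⟨G, hG, hg⟩
    exact ⟨F * G, hF.mul hG, fun z => by simp [hf, hg]⟩
  add_mem' := by
    rintro f g ⟨F, hF, hf⟩ ⟨G, hG, hg⟩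
    exact ⟨F + G, hF.add hG, fun z => by simp [hf, hg]⟩
  algebraMap_mem' c := ⟨fun _ => c, differentiableOn_const c, fun _ => rfl⟩

/-- The weight `(k! / |k|!)^{1/2}` of a multi-index `k`, where `k! = k₁! ⋯ kₙ!` and
`|k| = k₁ + ⋯ + kₙ`. -/
def ballWeight {n : ℕ} (k : Fin n →₀ ℕ) : ℝ :=
  √((∏ i, ((k i)! : ℝ)) / ((∑ i, k i)! : ℝ))

/-- The `k`-th term `|c_k| (k! / |k|!)^{1/2} ρ^{|k|}` of the norm `‖c‖_ρ`. -/
def ballTerm {n : ℕ} (ρ : ℝ) (c : MvPowerSeries (Fin n) ℂ) (k : Fin n →₀ ℕ) : ℝ :=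
  ‖MvPowerSeries.coeff k c‖ * ballWeight k * ρ ^ (∑ i, k i)

lemma ballTerm_nonneg {n : ℕ} {ρ : ℝ} (hρ : 0 < ρ) (c : MvPowerSeries (Fin n) ℂ)
    (k : Fin n →₀ ℕ) : 0 ≤ ballTerm ρ c k := by
  unfold ballTerm ballWeight
  positivity

lemma ballTerm_add_le {n : ℕ} {ρ : ℝ} (hρ : 0 < ρ) (c d : MvPowerSeries (Fin n) ℂ)
    (k : Fin n →₀ ℕ) : ballTerm ρ (c + d) k ≤ ballTerm ρ c k + ballTerm ρ d k := by
  have hw : 0 ≤ ballWeight k := Real.sqrt_nonneg _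
  unfold ballTerm
  rw [← add_mul, ← add_mul, map_add]
  gcongr
  exact norm_add_le _ _

lemma ballTerm_smul {n : ℕ} (ρ : ℝ) (a : ℂ) (c : MvPowerSeries (Fin n) ℂ)
    (k : Fin n →₀ ℕ) : ballTerm ρ (a • c) k = ‖a‖ * ballTerm ρ c k := by
  simp [ballTerm, mul_assoc]

/-- The radii `ρ ∈ (0, r)`. -/
abbrev SmallerRadius (r : ℝ≥0∞) : Type := {ρ : ℝ // 0 < ρ ∧ ENNReal.ofReal ρ < r}

/-- The space of all formal power series `c = ∑ c_k z^k` such that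
`∑ |c_k| (k! / |k|!)^{1/2} ρ^{|k|} < ∞` for all `ρ ∈ (0, r)`. -/
def ballSeries (n : ℕ) (r : ℝ≥0∞) : Submodule ℂ (MvPowerSeries (Fin n) ℂ) where
  carrier := {c | ∀ ρ : SmallerRadius r, Summable (ballTerm ρ.1 c)}
  zero_mem' ρ := by
    have h : ballTerm ρ.1 (0 : MvPowerSeries (Fin n) ℂ) = fun _ => 0 := by
      funext k
      simp [ballTerm]
    rw [h]
    exact summable_zero
  add_mem' := fun {c d} hc hd ρ =>
    Summable.of_nonneg_of_le (ballTerm_nonneg ρ.2.1 _) (ballTerm_add_le ρ.2.1 c d)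
      ((hc ρ).add (hd ρ))
  smul_mem' a c hc ρ := by
    have h : ballTerm ρ.1 (a • c) = fun k => ‖a‖ * ballTerm ρ.1 c k :=
      funext (ballTerm_smul ρ.1 a c)
    rw [h]
    exact (hc ρ).mul_left _

/-- The norms `‖c‖_ρ = ∑ |c_k| (k! / |k|!)^{1/2} ρ^{|k|}`, `ρ ∈ (0, r)`. -/
def ballSeriesNorm (n : ℕ) (r : ℝ≥0∞) : SeminormFamily ℂ (ballSeries n r) (SmallerRadius r) :=
  fun ρ => Seminorm.of (fun c => ∑' k, ballTerm ρ.1 c.1 k)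
    (fun c d => by
      rw [← (c.2 ρ).tsum_add (d.2 ρ)]
      exact ((c + d).2 ρ).tsum_le_tsum (ballTerm_add_le ρ.2.1 c.1 d.1)
        ((c.2 ρ).add (d.2 ρ)))
    (fun a c => by
      rw [← tsum_mul_left]
      exact tsum_congr (ballTerm_smul ρ.1 a c.1))

/-- The locally convex topology generated by the norms `‖·‖_ρ`, `ρ ∈ (0, r)`. -/
instance ballSeriesTopology (n : ℕ) (r : ℝ≥0∞) : TopologicalSpace (ballSeries n r) :=
  (ballSeriesNorm n r).moduleFilterBasis.topology

lemma ballSeries_withSeminorms (n : ℕ) (r : ℝ≥0∞) : WithSeminorms (ballSeriesNorm n r) :=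
  ⟨rfl⟩

end

/-!
The isomorphism is the inverse of the map `ballSeriesSum`, which sends a power series in
`ballSeries n r` to its sum on the ball.

**Sums are holomorphic and depend continuously on the series.** The weight `(k!/|k|!)^{1/2}` is
tailored to the multinomial formula: the single term of index `k` in the expansion of
`(∑ |z_i|²)^{|k|}` gives `|z^k| ≤ (k!/|k|!)^{1/2} ρ^{|k|}` whenever `∑ |z_i|² ≤ ρ²`
(`prod_norm_pow_le`). Hence the series converges absolutely, its supremum over the ball of radius
`ρ` is at most `‖c‖_ρ` (`norm_ballSeriesSum_le`), and the Schwarz lemma bounds the derivatives of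
the terms, so that it may be differentiated term by term (`differentiableOn_tsum_ballSeries`).

**Every holomorphic function is such a sum, with continuous dependence of the series.** Cauchy's
formula, applied in one variable at a time, expands the function in a power series on every closed
polydisc inside the ball, with Cauchy's estimates for the coefficients
(`exists_powerSeries_polydisc`). Coefficients are unique (`eq_zero_of_hasSum_monomial`), and these
polydiscs exhaust the ball, so a single series represents the function on all of the ball and
satisfies Cauchy's estimates on all polydiscs at once (`exists_taylorSeries`). For the coefficient
of index `k`, the polydisc with radii `R_i = ρ' √((k_i + 1)/(|k| + n))` inscribed in the ball of
radius `ρ'` is nearly optimal: by elementary bounds for factorials, it gives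
`|c_k| (k!/|k|!)^{1/2} ρ^{|k|} ≤ eⁿ M ∏ (k_i + 1) (ρ/ρ')^{k_i}`, where `M` is the supremum of the
function on that ball (`ballTerm_le_of_cauchy`). For `ρ < ρ'` the right-hand side is summable, and
so `‖c‖_ρ` is at most a constant times that supremum (`exists_ballSeriesSum_eq`).
-/

/-! ### Power series on polydiscs -/

/-- A product of summable nonnegative sequences in independent indices is summable over
multi-indices. -/
theorem summable_prod_apply {n : ℕ} (a : Fin n → ℕ → ℝ) (ha : ∀ i j, 0 ≤ a i j)
    (hs : ∀ i, Summable (a i)) : Summable fun k : Fin n → ℕ => ∏ i, a i (k i) := by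
  induction n with
  | zero => exact Summable.of_finite
  | succ n ih =>
    rw [← (Fin.consEquiv (fun _ => ℕ)).summable_iff]
    have h := (hs 0).mul_of_nonneg (ih (fun i => a i.succ) (fun i => ha _) (fun i => hs _))
      (fun j => ha 0 j) (fun k => Finset.prod_nonneg fun i _ => ha _ _)
    refine h.congr fun p => ?_
    simp [Fin.prod_univ_succ]

theorem hasSum_fin_cons_iff {n : ℕ} {f : (Fin (n + 1) → ℕ) → ℂ} {a : ℂ} :
    HasSum (fun p : ℕ × (Fin n → ℕ) => f (Fin.cons p.1 p.2)) a ↔ HasSum f a :=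
  (Fin.consEquiv fun _ => ℕ).hasSum_iff

theorem eq_zero_of_hasSum_pow {a : ℕ → ℂ} {R : ℝ} (hR : 0 < R)
    (h : ∀ z : ℂ, ‖z‖ < R → HasSum (fun j => a j * z ^ j) 0) : a = 0 := by
  have hp : HasFPowerSeriesAt (0 : ℂ → ℂ) (FormalMultilinearSeries.ofScalars ℂ a) 0 := by
    rw [hasFPowerSeriesAt_iff]
    filter_upwards [Metric.ball_mem_nhds (0 : ℂ) hR] with z hz
    simpa [FormalMultilinearSeries.coeff_ofScalars, mul_comm] using h z (by simpa using hz)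
  funext j
  rw [← FormalMultilinearSeries.coeff_ofScalars (𝕜 := ℂ) (p := a) (n := j), hp.eq_zero]
  simp [FormalMultilinearSeries.coeff]

/-- Uniqueness of power series coefficients on a polydisc, by induction on the number of variables:
for fixed values of the last `n` variables, the series is a power series in the first one. -/
theorem eq_zero_of_hasSum_monomial {n : ℕ} {c : (Fin n → ℕ) → ℂ} {R : Fin n → ℝ}
    (hR : ∀ i, 0 < R i)
    (h : ∀ z : Fin n → ℂ, (∀ i, ‖z i‖ < R i) → HasSum (fun k => c k * ∏ i, z i ^ k i) 0) :
    c = 0 := by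
  induction n with
  | zero =>
    funext k
    have := (hasSum_unique (fun k : Fin 0 → ℕ => c k * ∏ i, (0 : Fin 0 → ℂ) i ^ k i)).unique
      (h 0 (fun i => i.elim0))
    simp only [Finset.univ_eq_empty, Finset.prod_empty, mul_one] at this
    exact (congrArg c (Subsingleton.elim _ _)).trans this
  | succ n ih =>
    have key : ∀ w : Fin n → ℂ, (∀ i, ‖w i‖ < R i.succ) → ∀ j,
        HasSum (fun k : Fin n → ℕ => c (Fin.cons j k) * ∏ i, w i ^ k i) 0 := by
      intro w hw
      have hz : ∀ ζ : ℂ, ‖ζ‖ < R 0 → HasSum (fun p : ℕ × (Fin n → ℕ) =>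
          (c (Fin.cons p.1 p.2) * ∏ i, w i ^ p.2 i) * ζ ^ p.1) 0 := by
        intro ζ hζ
        have := h (Fin.cons ζ w) (Fin.cases (by simpa using hζ) (by simpa using hw))
        rw [← hasSum_fin_cons_iff] at this
        convert this using 2 with p
        simp only [Fin.prod_univ_succ, Fin.cons_zero, Fin.cons_succ]
        ring
      have hs : ∀ j, Summable (fun k : Fin n → ℕ => c (Fin.cons j k) * ∏ i, w i ^ k i) := by
        intro j
        have hR0 := hR 0
        have h1 := (hz ((R 0 / 2 : ℝ) : ℂ) (by
          rw [Complex.norm_real, Real.norm_of_nonneg (by positivity)]; linarith)).summable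
        have h2 := h1.comp_injective (Prod.mk_right_injective j)
        have hne : (((R 0 / 2 : ℝ) : ℂ)) ^ j ≠ 0 := by
          apply pow_ne_zero
          exact_mod_cast (by positivity : R 0 / 2 ≠ 0)
        exact (summable_mul_right_iff hne).1 h2
      have ha := eq_zero_of_hasSum_pow (a := fun j => ∑' k : Fin n → ℕ,
        c (Fin.cons j k) * ∏ i, w i ^ k i) (hR 0) fun ζ hζ => by
          have h1 : ∀ j, HasSum (fun k : Fin n → ℕ =>
              (c (Fin.cons j k) * ∏ i, w i ^ k i) * ζ ^ j) _ :=
            fun j => (hs j).hasSum.mul_right (ζ ^ j)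
          exact HasSum.prod_fiberwise (hz ζ hζ) h1
      intro j
      have := (hs j).hasSum
      rwa [show (∑' k : Fin n → ℕ, c (Fin.cons j k) * ∏ i, w i ^ k i) = 0 from
        congrFun ha j] at this
    funext k
    have := ih (c := fun k' => c (Fin.cons (k 0) k')) (fun i => hR i.succ)
      (fun w hw => key w hw (k 0))
    simpa using congrFun this (Fin.tail k)

/-- Power series expansion on a polydisc, with Cauchy's estimates, for a family of functions
depending continuously on a parameter `x : X`. The parameter makes the induction on the number of
variables possible: Cauchy's formula in the first variable integrates, over a circle, the expansions
in the remaining variables, and the angle on this circle becomes an additional parameter. -/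
theorem exists_powerSeries_polydisc {n : ℕ} : ∀ {X : Type} [TopologicalSpace X]
    (F : X → (Fin n → ℂ) → ℂ) (R : Fin n → ℝ) (M : ℝ), (∀ i, 0 < R i) →
    ContinuousOn (Function.uncurry F) (Set.univ ×ˢ {w | ∀ i, ‖w i‖ ≤ R i}) →
    (∀ x w, (∀ i, ‖w i‖ ≤ R i) → DifferentiableAt ℂ (F x) w) →
    (∀ x w, (∀ i, ‖w i‖ ≤ R i) → ‖F x w‖ ≤ M) →
    ∃ c : X → (Fin n → ℕ) → ℂ, (∀ k, Continuous (c · k)) ∧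
      (∀ x k, ‖c x k‖ * ∏ i, R i ^ k i ≤ M) ∧
      ∀ x z, (∀ i, ‖z i‖ < R i) → HasSum (fun k => c x k * ∏ i, z i ^ k i) (F x z) := by
  induction n with
  | zero =>
    intro X _ F R M _ hcont _ hM
    refine ⟨fun x _ => F x default, fun k => ?_, fun x k => ?_, fun x z _ => ?_⟩
    · exact hcont.comp_continuous (f := fun x => (x, default)) (by fun_prop) (by simp)
    · simpa using hM x default fun i => i.elim0
    · simp [Subsingleton.elim z default]
  | succ n ih =>
    intro X _ F R M hR hcont hdiff hM
    have hR0 := hR 0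
    have hmem : ∀ (ζ : ℂ) (w : Fin n → ℂ), ‖ζ‖ ≤ R 0 → (∀ i, ‖w i‖ ≤ R i.succ) →
        ∀ i, ‖(Fin.cons ζ w : Fin (n + 1) → ℂ) i‖ ≤ R i :=
      fun ζ w hζ hw => Fin.cases (by simpa using hζ) (by simpa using hw)
    have hcirc : ∀ θ : ℝ, ‖circleMap 0 (R 0) θ‖ = R 0 := fun θ => by
      simp [circleMap, abs_of_pos hR0]
    obtain ⟨c, hc, hcM, hcs⟩ := ih (X := X × ℝ)
      (fun p w => F p.1 (Fin.cons (circleMap 0 (R 0) p.2) w)) (fun i => R i.succ) M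
      (fun i => hR _) (by
        refine hcont.comp (f := fun q : (X × ℝ) × (Fin n → ℂ) =>
          (q.1.1, (Fin.cons (circleMap 0 (R 0) q.1.2) q.2 : Fin (n + 1) → ℂ))) ?_ ?_
        · refine Continuous.continuousOn ?_
          have h1 : Continuous fun q : (X × ℝ) × (Fin n → ℂ) => q.1.1 := by fun_prop
          refine h1.prodMk (continuous_pi (Fin.cases ?_ fun i => ?_))
          · simp only [Fin.cons_zero]; fun_prop
          · simp only [Fin.cons_succ]; fun_prop
        · rintro ⟨⟨x, θ⟩, w⟩ ⟨-, hw⟩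
          exact ⟨trivial, hmem _ _ (hcirc θ).le hw⟩)
      (by
        rintro ⟨x, θ⟩ w hw
        refine (hdiff x _ (hmem _ _ (hcirc θ).le hw)).comp w ?_
        refine differentiableAt_pi.2 (Fin.cases ?_ fun i => ?_)
        · simp
        · simp only [Fin.cons_succ]; fun_prop)
      (by
        rintro ⟨x, θ⟩ w hw
        exact hM x _ (hmem _ _ (hcirc θ).le hw))
    have hne : ∀ θ, circleMap 0 (R 0) θ ≠ 0 := fun θ => circleMap_ne_center hR0.ne'
    have hg : ∀ (j : ℕ) (k : Fin n → ℕ), Continuous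
        (fun p : X × ℝ => (circleMap 0 (R 0) p.2)⁻¹ ^ j * c p k) := by
      intro j k
      have h1 : Continuous fun p : X × ℝ => (circleMap 0 (R 0) p.2)⁻¹ :=
        Continuous.inv₀ (by fun_prop) fun p => hne _
      exact (h1.pow j).mul (hc k)
    -- The coefficients are the circle averages of `ζ ^ (-k 0)` times the coefficients in the
    -- remaining variables.
    refine ⟨fun x k => (2 * Real.pi : ℝ)⁻¹ • ∫ θ in (0 : ℝ)..2 * Real.pi,
      (circleMap 0 (R 0) θ)⁻¹ ^ k 0 * c (x, θ) (Fin.tail k), fun k => ?_, fun x k => ?_,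
      fun x z hz => ?_⟩
    · have h : Continuous fun x => ∫ θ in (0 : ℝ)..2 * Real.pi,
          (circleMap 0 (R 0) θ)⁻¹ ^ k 0 * c (x, θ) (Fin.tail k) :=
        intervalIntegral.continuous_parametric_intervalIntegral_of_continuous' (hg _ _) _ _
      exact h.const_smul ((2 * Real.pi : ℝ)⁻¹)
    · have hP : 0 < ∏ i : Fin n, R i.succ ^ k i.succ :=
        Finset.prod_pos fun i _ => pow_pos (hR _) _
      have hb : ‖∫ θ in (0 : ℝ)..2 * Real.pi,
          (circleMap 0 (R 0) θ)⁻¹ ^ k 0 * c (x, θ) (Fin.tail k)‖ ≤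
          ((R 0)⁻¹ ^ k 0 * (M / ∏ i : Fin n, R i.succ ^ k i.succ)) * |2 * Real.pi - 0| := by
        refine intervalIntegral.norm_integral_le_of_norm_le_const fun θ _ => ?_
        rw [norm_mul, norm_pow, norm_inv, hcirc]
        gcongr
        rw [le_div_iff₀ hP]
        exact hcM (x, θ) (Fin.tail k)
      have hpi := Real.pi_pos
      rw [norm_smul, Fin.prod_univ_succ, Real.norm_of_nonneg (by positivity)]
      rw [sub_zero, abs_of_pos (by positivity)] at hb
      calc _ ≤ (2 * Real.pi)⁻¹ * (((R 0)⁻¹ ^ k 0 * (M / ∏ i : Fin n, R i.succ ^ k i.succ)) *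
            (2 * Real.pi)) * (R 0 ^ k 0 * ∏ i : Fin n, R i.succ ^ k i.succ) := by gcongr
        _ = M := by
          have : R 0 ^ k 0 ≠ 0 := (pow_pos hR0 _).ne'
          rw [inv_pow]
          field_simp
    · have hz0 : ‖z 0‖ < R 0 := hz 0
      set q : ℝ := ‖z 0‖ / R 0 with hq
      have hq0 : 0 ≤ q := by positivity
      have hq1 : q < 1 := (div_lt_one hR0).2 hz0
      have hM0 : 0 ≤ M := (norm_nonneg _).trans (hM x z fun i => (hz i).le)
      have hgeo : Summable fun k : Fin n → ℕ => ∏ i, (‖z i.succ‖ / R i.succ) ^ k i :=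
        summable_prod_apply (fun i j => (‖z i.succ‖ / R i.succ) ^ j)
          (fun i j => pow_nonneg (div_nonneg (norm_nonneg _) (hR _).le) _)
          (fun i => summable_geometric_of_lt_one (div_nonneg (norm_nonneg _) (hR _).le)
            ((div_lt_one (hR _)).2 (hz _)))
      have hbd : Summable fun p : ℕ × (Fin n → ℕ) =>
          q ^ p.1 * (M * ∏ i, (‖z i.succ‖ / R i.succ) ^ p.2 i) :=
        (summable_geometric_of_lt_one hq0 hq1).mul_of_nonneg (hgeo.mul_left M)
          (fun j => pow_nonneg hq0 j) (fun k => mul_nonneg hM0 (Finset.prod_nonneg fun i _ =>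
            pow_nonneg (div_nonneg (norm_nonneg _) (hR _).le) _))
      have hle1 : ∀ θ j, ‖(z 0 / circleMap 0 (R 0) θ) ^ j‖ ≤ q ^ j := fun θ j => by
        rw [norm_pow, norm_div, hcirc]
      have hle2 : ∀ θ (k : Fin n → ℕ), ‖c (x, θ) k * ∏ i, z i.succ ^ k i‖ ≤
          M * ∏ i, (‖z i.succ‖ / R i.succ) ^ k i := fun θ k => by
        have hP : 0 < ∏ i : Fin n, R i.succ ^ k i := Finset.prod_pos fun i _ => pow_pos (hR _) _
        rw [norm_mul, norm_prod]
        simp only [norm_pow, div_pow, Finset.prod_div_distrib]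
        rw [mul_div_assoc', mul_comm M, ← mul_div_assoc', mul_comm]
        gcongr
        rw [le_div_iff₀ hP]
        exact hcM (x, θ) k
      have hle : ∀ θ (p : ℕ × (Fin n → ℕ)), ‖(z 0 / circleMap 0 (R 0) θ) ^ p.1 *
          (c (x, θ) p.2 * ∏ i, z i.succ ^ p.2 i)‖ ≤
          q ^ p.1 * (M * ∏ i, (‖z i.succ‖ / R i.succ) ^ p.2 i) := fun θ p => by
        rw [norm_mul]
        gcongr
        · exact hle1 θ p.1
        · exact hle2 θ p.2
      -- Expand `ζ / (ζ - z 0) * F x (ζ, z 1, …, z n)` in powers of `z 0 / ζ` and of the remaining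
      -- variables, and integrate term by term.
      have hsum := intervalIntegral.hasSum_integral_of_dominated_convergence
        (μ := MeasureTheory.volume) (a := 0) (b := 2 * Real.pi)
        (F := fun (p : ℕ × (Fin n → ℕ)) θ => (z 0 / circleMap 0 (R 0) θ) ^ p.1 *
          (c (x, θ) p.2 * ∏ i, z i.succ ^ p.2 i))
        (f := fun θ => (circleMap 0 (R 0) θ / (circleMap 0 (R 0) θ - z 0)) *
          F x (Fin.cons (circleMap 0 (R 0) θ) (Fin.tail z)))
        (fun p _ => q ^ p.1 * (M * ∏ i, (‖z i.succ‖ / R i.succ) ^ p.2 i))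
        (fun p => by
          refine Continuous.aestronglyMeasurable ?_
          have h1 : Continuous fun θ : ℝ => z 0 / circleMap 0 (R 0) θ :=
            Continuous.div continuous_const (by fun_prop) hne
          have h2 : Continuous fun θ : ℝ => c (x, θ) p.2 :=
            (hc p.2).comp (Continuous.prodMk_right x)
          exact (h1.pow _).mul (h2.mul continuous_const))
        (fun p => Filter.Eventually.of_forall fun θ _ => hle θ p)
        (Filter.Eventually.of_forall fun θ _ => hbd)
        intervalIntegrable_const
        (Filter.Eventually.of_forall fun θ _ => by
          have hlt : ‖z 0 / circleMap 0 (R 0) θ‖ < 1 := by rw [norm_div, hcirc]; exact hq1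
          have h1 := hasSum_geometric_of_norm_lt_one hlt
          have h2 := hcs (x, θ) (Fin.tail z) fun i => hz i.succ
          have h3 := h1.mul h2 (Summable.of_norm_bounded hbd (hle θ))
          have hsub : circleMap 0 (R 0) θ - z 0 ≠ 0 := by
            intro h
            rw [sub_eq_zero] at h
            rw [← h, hcirc] at hz0
            exact lt_irrefl _ hz0
          have hsub' : 1 - z 0 / circleMap 0 (R 0) θ ≠ 0 := by
            intro h
            apply hsub
            rw [sub_eq_zero, eq_div_iff (hne θ), one_mul] at h
            rw [h, sub_self]
          have h4 : circleMap 0 (R 0) θ / (circleMap 0 (R 0) θ - z 0) =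
              (1 - z 0 / circleMap 0 (R 0) θ)⁻¹ := by
            have := hne θ
            refine eq_inv_of_mul_eq_one_left ?_
            field_simp
          rw [h4]
          exact h3)
      have hcauchy : (2 * Real.pi : ℝ)⁻¹ • (∫ θ in (0 : ℝ)..2 * Real.pi,
          (circleMap 0 (R 0) θ / (circleMap 0 (R 0) θ - z 0)) *
          F x (Fin.cons (circleMap 0 (R 0) θ) (Fin.tail z))) = F x z := by
        have hd : DiffContOnCl ℂ (fun ζ => F x (Fin.cons ζ (Fin.tail z)))
            (Metric.ball 0 |R 0|) := by
          refine DifferentiableOn.diffContOnCl fun ζ hζ =>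
            DifferentiableAt.differentiableWithinAt ?_
          rw [closure_ball _ (abs_pos.2 hR0.ne').ne', mem_closedBall_zero_iff,
            abs_of_pos hR0] at hζ
          refine (hdiff x _ (hmem ζ _ hζ fun i => (hz i.succ).le)).comp ζ ?_
          refine differentiableAt_pi.2 (Fin.cases ?_ fun i => ?_)
          · simp
          · simp
        have h := hd.circleAverage_smul_div (w := z 0) (by
          rw [mem_ball_zero_iff, abs_of_pos hR0]; exact hz0)
        rw [Real.circleAverage_def] at h
        simpa using h
      have hfin := hsum.const_smul (2 * Real.pi : ℝ)⁻¹
      rw [hcauchy] at hfin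
      rw [← hasSum_fin_cons_iff]
      refine hfin.congr_fun fun p => ?_
      simp only [Fin.cons_zero, Fin.tail_cons, Fin.prod_univ_succ, Fin.cons_succ]
      rw [smul_mul_assoc, ← intervalIntegral.integral_mul_const]
      congr 1
      refine intervalIntegral.integral_congr fun θ _ => ?_
      simp only [div_pow, inv_pow]
      ring

/-! ### The geometry of the ball -/

theorem sum_enorm_sq_eq_ofReal {n : ℕ} (z : Fin n → ℂ) :
    ∑ i, ‖z i‖ₑ ^ 2 = ENNReal.ofReal (∑ i, ‖z i‖ ^ 2) := by
  rw [ENNReal.ofReal_sum_of_nonneg fun i _ => by positivity]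
  refine Finset.sum_congr rfl fun i _ => ?_
  rw [ENNReal.ofReal_pow (norm_nonneg _), ofReal_norm]

theorem mem_complexBall_of_sum_le {n : ℕ} {r : ℝ≥0∞} (ρ : SmallerRadius r) {z : Fin n → ℂ}
    (hz : ∑ i, ‖z i‖ ^ 2 ≤ ρ.1 ^ 2) : z ∈ complexBall n r := by
  change ∑ i, ‖z i‖ₑ ^ 2 < r ^ 2
  rw [sum_enorm_sq_eq_ofReal]
  refine (ENNReal.ofReal_le_ofReal hz).trans_lt ?_
  rw [ENNReal.ofReal_pow ρ.2.1.le]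
  exact ENNReal.pow_right_strictMono two_ne_zero ρ.2.2

theorem exists_radius_of_mem_complexBall {n : ℕ} {r : ℝ≥0∞} {z : Fin n → ℂ}
    (hz : z ∈ complexBall n r) : ∃ ρ : SmallerRadius r, ∑ i, ‖z i‖ ^ 2 < ρ.1 ^ 2 := by
  have hS : 0 ≤ ∑ i, ‖z i‖ ^ 2 := Finset.sum_nonneg fun i _ => by positivity
  change ∑ i, ‖z i‖ₑ ^ 2 < r ^ 2 at hz
  rw [sum_enorm_sq_eq_ofReal, ← Real.sq_sqrt hS, ENNReal.ofReal_pow (Real.sqrt_nonneg _)] at hz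
  have h1 : ENNReal.ofReal √(∑ i, ‖z i‖ ^ 2) < r := lt_of_pow_lt_pow_left' 2 hz
  obtain ⟨ρ, hρ0, h2, h3⟩ := ENNReal.lt_iff_exists_real_btwn.1 h1
  have h4 := (ENNReal.ofReal_lt_ofReal_iff').1 h2
  refine ⟨⟨ρ, h4.2, h3⟩, ?_⟩
  rw [← Real.sqrt_lt' h4.2]
  exact h4.1

theorem exists_radius_gt {r : ℝ≥0∞} (ρ : SmallerRadius r) :
    ∃ ρ' : SmallerRadius r, ρ.1 < ρ'.1 := by
  obtain ⟨ρ', -, h2, h3⟩ := ENNReal.lt_iff_exists_real_btwn.1 ρ.2.2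
  have h4 := ENNReal.ofReal_lt_ofReal_iff'.1 h2
  exact ⟨⟨ρ', h4.2, h3⟩, h4.1⟩

theorem isOpen_complexBall (n : ℕ) (r : ℝ≥0∞) : IsOpen (complexBall n r) := by
  refine isOpen_lt ?_ continuous_const
  exact continuous_finsetSum _ fun i _ =>
    (ENNReal.continuous_pow 2).comp (continuous_enorm.comp (continuous_apply i))

theorem zero_mem_complexBall (n : ℕ) {r : ℝ≥0∞} (hr : 0 < r) :
    (0 : Fin n → ℂ) ∈ complexBall n r := by
  change ∑ i, ‖(0 : Fin n → ℂ) i‖ₑ ^ 2 < r ^ 2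
  simpa using ENNReal.pow_pos hr 2

/-- The ball is a complete Reinhardt domain. -/
theorem mem_complexBall_of_norm_le {n : ℕ} {r : ℝ≥0∞} {z w : Fin n → ℂ}
    (hz : z ∈ complexBall n r) (h : ∀ i, ‖w i‖ ≤ ‖z i‖) : w ∈ complexBall n r := by
  change ∑ i, ‖z i‖ₑ ^ 2 < r ^ 2 at hz
  refine lt_of_le_of_lt (Finset.sum_le_sum fun i _ => ?_) hz
  gcongr
  simpa [← ofReal_norm] using ENNReal.ofReal_le_ofReal (h i)

theorem exists_radius_of_isCompact {n : ℕ} {r : ℝ≥0∞} (hr : 0 < r) {K : Set (complexBall n r)}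
    (hK : IsCompact K) : ∃ ρ : SmallerRadius r, ∀ z ∈ K, ∑ i, ‖z.1 i‖ ^ 2 ≤ ρ.1 ^ 2 := by
  obtain rfl | hne := K.eq_empty_or_nonempty
  · obtain ⟨ρ, -⟩ := exists_radius_of_mem_complexBall (zero_mem_complexBall n hr)
    exact ⟨ρ, by simp⟩
  · obtain ⟨z, -, hz⟩ := hK.exists_isMaxOn (f := fun z : complexBall n r => ∑ i, ‖z.1 i‖ ^ 2) hne
      (Continuous.continuousOn (continuous_finsetSum _ fun i _ =>
        ((continuous_apply i).comp continuous_subtype_val).norm.pow 2))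
    obtain ⟨ρ, hρ⟩ := exists_radius_of_mem_complexBall z.2
    exact ⟨ρ, fun w hw => (hz hw).trans hρ.le⟩

theorem isCompact_closedBall_complexBall {n : ℕ} {r : ℝ≥0∞} (ρ : SmallerRadius r) :
    IsCompact {z : complexBall n r | ∑ i, ‖z.1 i‖ ^ 2 ≤ ρ.1 ^ 2} := by
  rw [Subtype.isCompact_iff]
  have hc : IsCompact (Set.univ.pi fun _ : Fin n => Metric.closedBall (0 : ℂ) ρ.1) :=
    isCompact_univ_pi fun _ => isCompact_closedBall _ _
  have hcl : IsClosed {z : Fin n → ℂ | ∑ i, ‖z i‖ ^ 2 ≤ ρ.1 ^ 2} :=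
    isClosed_le (by fun_prop) continuous_const
  refine hc.of_isClosed_subset (s := _) ?_ ?_
  · convert hcl using 1
    ext z
    constructor
    · rintro ⟨w, hw, rfl⟩
      exact hw
    · intro hz
      exact ⟨⟨z, mem_complexBall_of_sum_le ρ hz⟩, hz, rfl⟩
  · rintro _ ⟨w, hw, rfl⟩ i -
    rw [mem_closedBall_zero_iff]
    refine le_of_sq_le_sq ?_ ρ.2.1.le
    exact (Finset.single_le_sum (f := fun i => ‖w.1 i‖ ^ 2) (fun i _ => by positivity)
      (Finset.mem_univ i)).trans hw

/-! ### Estimates for the weights -/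

theorem ballWeight_nonneg {n : ℕ} (k : Fin n →₀ ℕ) : 0 ≤ ballWeight k := Real.sqrt_nonneg _

/-- The single term with index `k` of the multinomial expansion of `(∑ |z_i|²)^{|k|}` bounds the
monomial `z^k`. -/
theorem prod_norm_pow_le {n : ℕ} {ρ : ℝ} (hρ : 0 ≤ ρ) {z : Fin n → ℂ}
    (hz : ∑ i, ‖z i‖ ^ 2 ≤ ρ ^ 2) (k : Fin n →₀ ℕ) :
    ∏ i, ‖z i‖ ^ k i ≤ ballWeight k * ρ ^ ∑ i, k i := by
  refine le_of_sq_le_sq ?_ (mul_nonneg (ballWeight_nonneg k) (pow_nonneg hρ _))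
  set m := ∑ i, k i with hm
  have h1 : (Nat.multinomial Finset.univ k : ℝ) * ∏ i, (‖z i‖ ^ 2) ^ k i ≤ (ρ ^ 2) ^ m := by
    refine le_trans ?_ (pow_le_pow_left₀ (Finset.sum_nonneg fun i _ => by positivity) hz m)
    rw [Finset.sum_pow_eq_sum_piAntidiag]
    refine Finset.single_le_sum (f := fun k : Fin n → ℕ =>
      (Nat.multinomial Finset.univ k : ℝ) * ∏ i, (‖z i‖ ^ 2) ^ k i)
      (fun k _ => mul_nonneg (Nat.cast_nonneg _) (Finset.prod_nonneg fun i _ => by positivity))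
      (a := ⇑k) ?_
    simp [hm]
  have h2 : (∏ i, ((k i)! : ℝ)) * (Nat.multinomial Finset.univ k : ℝ) = (m ! : ℝ) := by
    exact_mod_cast Nat.multinomial_spec Finset.univ k
  have hf : 0 < ∏ i, ((k i)! : ℝ) := Finset.prod_pos fun i _ => by positivity
  have hm0 : (0 : ℝ) < (m ! : ℝ) := by positivity
  rw [mul_pow, ballWeight, Real.sq_sqrt (by positivity), ← Finset.prod_pow, ← pow_mul,
    mul_comm m 2, pow_mul, div_mul_eq_mul_div, le_div_iff₀ hm0, ← h2]
  calc _ = (∏ i, ((k i)! : ℝ)) *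
        ((Nat.multinomial Finset.univ k : ℝ) * ∏ i, (‖z i‖ ^ 2) ^ k i) := by
        simp_rw [← pow_mul, mul_comm 2]
        ring
    _ ≤ _ := by gcongr

theorem norm_term_le_ballTerm {n : ℕ} {ρ : ℝ} (hρ : 0 ≤ ρ) {z : Fin n → ℂ}
    (hz : ∑ i, ‖z i‖ ^ 2 ≤ ρ ^ 2) (c : MvPowerSeries (Fin n) ℂ) (k : Fin n →₀ ℕ) :
    ‖MvPowerSeries.coeff k c * ∏ i, z i ^ k i‖ ≤ ballTerm ρ c k := by
  rw [norm_mul, norm_prod, ballTerm, mul_assoc]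
  simp only [norm_pow]
  gcongr
  exact prod_norm_pow_le hρ hz k

/-- An elementary form of Stirling's upper bound, which follows from `(1 - 1/(k+2))^(k+2) ≤ 1/e`. -/
theorem factorial_mul_exp_le (k : ℕ) : (k ! : ℝ) * Real.exp k ≤ ((k : ℝ) + 1) ^ (k + 1) := by
  induction k with
  | zero => simp
  | succ k ih =>
    have h := Real.one_sub_div_pow_le_exp_neg (n := k + 2) (t := 1) (by push_cast; linarith)
    have h1 : (1 : ℝ) - 1 / ((k + 2 : ℕ) : ℝ) = (k + 1) / (k + 2) := by
      push_cast
      field_simp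
      ring
    rw [h1, div_pow, div_le_iff₀ (by positivity), Real.exp_neg, ← div_eq_inv_mul,
      le_div_iff₀ (Real.exp_pos _)] at h
    push_cast [Nat.factorial_succ]
    rw [Real.exp_add]
    calc ((k : ℝ) + 1) * (k ! : ℝ) * (Real.exp k * Real.exp 1)
        = (((k ! : ℝ) * Real.exp k) * (k + 1)) * Real.exp 1 := by ring
      _ ≤ (((k : ℝ) + 1) ^ (k + 1) * (k + 1)) * Real.exp 1 := by gcongr
      _ = ((k : ℝ) + 1) ^ (k + 2) * Real.exp 1 := by ring
      _ ≤ ((k : ℝ) + 2) ^ (k + 2) := h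
      _ = _ := by ring

/-- Comparison of the weight with the monomial at the radii `R_i = √((k_i + 1) / (|k| + n))`, which
satisfy `∑ R_i² = 1` if `n ≥ 1`. Adding `1` to each `k_i` keeps the radii positive. -/
theorem ballWeight_le {n : ℕ} (k : Fin n →₀ ℕ) :
    ballWeight k ≤ (Real.exp n * ∏ i, ((k i : ℝ) + 1)) *
      ∏ i, √(((k i : ℝ) + 1) / ((∑ i, k i : ℕ) + n)) ^ k i := by
  set m := ∑ i, k i with hm
  have hP : 1 ≤ ∏ i, ((k i : ℝ) + 1) := Finset.one_le_prod fun i _ => by simp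
  have hE : 1 ≤ Real.exp n := Real.one_le_exp (Nat.cast_nonneg n)
  refine le_of_sq_le_sq ?_ (by positivity)
  have hm0 : (0 : ℝ) < (m ! : ℝ) := by positivity
  have hQ : (∏ i, √(((k i : ℝ) + 1) / ((m : ℝ) + n)) ^ k i) ^ 2 =
      (∏ i, ((k i : ℝ) + 1) ^ k i) / ((m : ℝ) + n) ^ m := by
    rw [← Finset.prod_pow, hm, ← Finset.prod_pow_eq_pow_sum, ← Finset.prod_div_distrib]
    refine Finset.prod_congr rfl fun i _ => ?_
    rw [← pow_mul, mul_comm, pow_mul, Real.sq_sqrt (by positivity), div_pow]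
  rw [mul_pow, hQ, ballWeight, Real.sq_sqrt (by positivity)]
  have hmn : 0 < ((m : ℝ) + n) ^ m := by
    rcases Nat.eq_zero_or_pos m with h | h
    · simp [h]
    · have : (0 : ℝ) < m := by exact_mod_cast h
      positivity
  rw [mul_div_assoc', div_le_div_iff₀ hm0 hmn]
  have h1 : ((m : ℝ) + n) ^ m ≤ Real.exp m * Real.exp n * (m ! : ℝ) := by
    rw [← Real.exp_add, ← div_le_iff₀ hm0]
    exact Real.pow_div_factorial_le_exp _ (by positivity) m
  have h2 : (∏ i, ((k i)! : ℝ)) * Real.exp m ≤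
      (∏ i, ((k i : ℝ) + 1)) * ∏ i, ((k i : ℝ) + 1) ^ k i := by
    rw [hm, Nat.cast_sum, Real.exp_sum, ← Finset.prod_mul_distrib, ← Finset.prod_mul_distrib]
    refine Finset.prod_le_prod (fun i _ => by positivity) fun i _ => ?_
    rw [← pow_succ']
    exact factorial_mul_exp_le _
  calc (∏ i, ((k i)! : ℝ)) * ((m : ℝ) + n) ^ m
      ≤ (∏ i, ((k i)! : ℝ)) * (Real.exp m * Real.exp n * (m ! : ℝ)) := by gcongr
    _ = ((∏ i, ((k i)! : ℝ)) * Real.exp m) * (Real.exp n * (m ! : ℝ)) := by ring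
    _ ≤ ((∏ i, ((k i : ℝ) + 1)) * ∏ i, ((k i : ℝ) + 1) ^ k i) * (Real.exp n * (m ! : ℝ)) := by
      gcongr
    _ = (Real.exp n * ∏ i, ((k i : ℝ) + 1)) * (∏ i, ((k i : ℝ) + 1) ^ k i) * (m ! : ℝ) := by ring
    _ ≤ _ := by
      gcongr
      exact le_self_pow₀ (one_le_mul_of_one_le_of_one_le hE hP) two_ne_zero

theorem summable_weight {n : ℕ} {q : ℝ} (hq0 : 0 ≤ q) (hq1 : q < 1) :
    Summable fun k : Fin n →₀ ℕ => ∏ i, (((k i : ℝ) + 1) * q ^ k i) := by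
  have hs : Summable fun j : ℕ => ((j : ℝ) + 1) * q ^ j := by
    have h1 := summable_pow_mul_geometric_of_norm_lt_one 1
      (by rwa [Real.norm_of_nonneg hq0] : ‖q‖ < 1)
    refine (h1.add (summable_geometric_of_lt_one hq0 hq1)).congr fun j => ?_
    ring
  have h := summable_prod_apply (fun (_ : Fin n) (j : ℕ) => ((j : ℝ) + 1) * q ^ j)
    (fun _ j => by positivity) fun _ => hs
  exact h.comp_injective (DFunLike.coe_injective (F := Fin n →₀ ℕ))

/-- Cauchy estimates on all polydiscs inscribed in a ball of radius `ρ'` control the terms of the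
norm of a smaller radius `ρ`. -/
theorem ballTerm_le_of_cauchy {n : ℕ} {ρ ρ' M : ℝ} (hρ : 0 < ρ) (hρ' : 0 < ρ')
    {c : MvPowerSeries (Fin n) ℂ} {k : Fin n →₀ ℕ}
    (h : ∀ R : Fin n → ℝ, (∀ i, 0 < R i) → ∑ i, R i ^ 2 ≤ ρ' ^ 2 →
      ‖MvPowerSeries.coeff k c‖ * ∏ i, R i ^ k i ≤ M) :
    ballTerm ρ c k ≤ M * Real.exp n * ∏ i, (((k i : ℝ) + 1) * (ρ / ρ') ^ k i) := by
  set m := ∑ i, k i with hm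
  set t : Fin n → ℝ := fun i => √(((k i : ℝ) + 1) / ((m : ℝ) + n)) with ht
  have hden : ∀ _ : Fin n, (0 : ℝ) < m + n := fun i => by
    have : 0 < n := i.pos
    have : (0 : ℝ) < n := by exact_mod_cast this
    positivity
  have h1 := h (fun i => ρ' * t i)
    (fun i => mul_pos hρ' (Real.sqrt_pos.2 (div_pos (by positivity) (hden i)))) (by
      have h2 : ∀ i, (ρ' * t i) ^ 2 = ρ' ^ 2 * (((k i : ℝ) + 1) / ((m : ℝ) + n)) := fun i => by
        rw [mul_pow, ht, Real.sq_sqrt (by positivity)]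
      simp_rw [h2]
      rw [← Finset.mul_sum, ← Finset.sum_div]
      have h3 : ∑ i, ((k i : ℝ) + 1) = (m : ℝ) + n := by
        rw [Finset.sum_add_distrib, hm]
        simp
      rw [h3]
      -- For `n = 0` the quotient is `0 / 0 = 0`, so only `≤ 1` is available.
      exact mul_le_of_le_one_right (by positivity) (div_self_le_one _))
  simp only [mul_pow, Finset.prod_mul_distrib] at h1
  rw [Finset.prod_pow_eq_pow_sum, ← hm] at h1
  rw [ballTerm, ← hm]
  have hw := ballWeight_le k
  rw [← hm] at hw
  have hP : ∏ i, (((k i : ℝ) + 1) * (ρ / ρ') ^ k i) =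
      (∏ i, ((k i : ℝ) + 1)) * (ρ / ρ') ^ m := by
    rw [Finset.prod_mul_distrib, Finset.prod_pow_eq_pow_sum]
  rw [hP]
  calc ‖MvPowerSeries.coeff k c‖ * ballWeight k * ρ ^ m
      ≤ ‖MvPowerSeries.coeff k c‖ * ((Real.exp n * ∏ i, ((k i : ℝ) + 1)) * ∏ i, t i ^ k i) *
        ρ ^ m := by gcongr
    _ = (‖MvPowerSeries.coeff k c‖ * (ρ' ^ m * ∏ i, t i ^ k i)) * Real.exp n *
        ((∏ i, ((k i : ℝ) + 1)) * (ρ / ρ') ^ m) := by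
      rw [div_pow]
      have : ρ' ^ m ≠ 0 := (pow_pos hρ' m).ne'
      field_simp
    _ ≤ M * Real.exp n * ((∏ i, ((k i : ℝ) + 1)) * (ρ / ρ') ^ m) := by gcongr

/-! ### Taylor series of holomorphic functions on the ball -/

theorem mvPowerSeries_ext_of_hasSum {n : ℕ}
    {c d : MvPowerSeries (Fin n) ℂ} {F : (Fin n → ℂ) → ℂ} {R : Fin n → ℝ} (hR : ∀ i, 0 < R i)
    (hc : ∀ z : Fin n → ℂ, (∀ i, ‖z i‖ < R i) →
      HasSum (fun k : Fin n →₀ ℕ => MvPowerSeries.coeff k c * ∏ i, z i ^ k i) (F z))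
    (hd : ∀ z : Fin n → ℂ, (∀ i, ‖z i‖ < R i) →
      HasSum (fun k : Fin n →₀ ℕ => MvPowerSeries.coeff k d * ∏ i, z i ^ k i) (F z)) : c = d := by
  have h := eq_zero_of_hasSum_monomial (n := n)
    (c := fun k => MvPowerSeries.coeff (Finsupp.equivFunOnFinite.symm k) (c - d)) hR
    fun z hz => by
      have h1 := (hc z hz).sub (hd z hz)
      rw [sub_self] at h1
      rw [← (Finsupp.equivFunOnFinite (α := Fin n) (M := ℕ)).hasSum_iff]
      refine h1.congr_fun fun k => ?_
      simp [sub_mul]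
  ext k
  have := congrFun h (Finsupp.equivFunOnFinite k)
  simpa [sub_eq_zero] using this

/-- The power series expansion of a holomorphic function on a closed polydisc contained in the
ball, with Cauchy's estimates. -/
theorem exists_mvPowerSeries_polydisc {n : ℕ} {r : ℝ≥0∞} {F : (Fin n → ℂ) → ℂ}
    (hF : DifferentiableOn ℂ F (complexBall n r)) {R : Fin n → ℝ} (hR : ∀ i, 0 < R i)
    (hRr : (fun i => (R i : ℂ)) ∈ complexBall n r) {M : ℝ}
    (hM : ∀ w : Fin n → ℂ, (∀ i, ‖w i‖ ≤ R i) → ‖F w‖ ≤ M) :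
    ∃ c : MvPowerSeries (Fin n) ℂ,
      (∀ k : Fin n →₀ ℕ, ‖MvPowerSeries.coeff k c‖ * ∏ i, R i ^ k i ≤ M) ∧
      ∀ z : Fin n → ℂ, (∀ i, ‖z i‖ < R i) →
        HasSum (fun k : Fin n →₀ ℕ => MvPowerSeries.coeff k c * ∏ i, z i ^ k i) (F z) := by
  have hsub : ∀ w : Fin n → ℂ, (∀ i, ‖w i‖ ≤ R i) → w ∈ complexBall n r := fun w hw =>
    mem_complexBall_of_norm_le hRr fun i => by simpa [abs_of_pos (hR i)] using hw i
  have hd : ∀ w : Fin n → ℂ, (∀ i, ‖w i‖ ≤ R i) → DifferentiableAt ℂ F w := fun w hw =>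
    (hF w (hsub w hw)).differentiableAt ((isOpen_complexBall n r).mem_nhds (hsub w hw))
  obtain ⟨c, -, hcM, hcs⟩ := exists_powerSeries_polydisc (fun _ : Unit => F) R M hR
    (by
      rintro ⟨x, w⟩ ⟨-, hw⟩
      have h1 : ContinuousAt F (x, w).2 := (hd w hw).continuousAt
      exact (h1.comp continuousAt_snd).continuousWithinAt)
    (fun _ w hw => hd w hw) (fun _ w hw => hM w hw)
  refine ⟨fun k => c () k, fun k => hcM () k, fun z hz => ?_⟩
  have h := hcs () z hz
  rw [← (Finsupp.equivFunOnFinite (α := Fin n) (M := ℕ)).hasSum_iff] at h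
  exact h

/-- A holomorphic function on the ball is the sum of a power series satisfying Cauchy's estimates
on every polydisc contained in the ball. -/
theorem exists_taylorSeries {n : ℕ} {r : ℝ≥0∞} (hr : 0 < r) {F : (Fin n → ℂ) → ℂ}
    (hF : DifferentiableOn ℂ F (complexBall n r)) :
    ∃ c : MvPowerSeries (Fin n) ℂ,
      (∀ (R : Fin n → ℝ) (M : ℝ), (∀ i, 0 < R i) → (fun i => (R i : ℂ)) ∈ complexBall n r →
        (∀ w : Fin n → ℂ, (∀ i, ‖w i‖ ≤ R i) → ‖F w‖ ≤ M) →
        ∀ k : Fin n →₀ ℕ, ‖MvPowerSeries.coeff k c‖ * ∏ i, R i ^ k i ≤ M) ∧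
      ∀ z ∈ complexBall n r,
        HasSum (fun k : Fin n →₀ ℕ => MvPowerSeries.coeff k c * ∏ i, z i ^ k i) (F z) := by
  have hrad : ∀ z ∈ complexBall n r, ∃ R : Fin n → ℝ, (∀ i, 0 < R i) ∧ (∀ i, ‖z i‖ < R i) ∧
      (fun i => (R i : ℂ)) ∈ complexBall n r := by
    intro z hz
    have h0 : (fun i => ((‖z i‖ + 0 : ℝ) : ℂ)) ∈ complexBall n r :=
      mem_complexBall_of_norm_le hz fun i => by simp
    have hcont : Continuous fun ε : ℝ => fun i => ((‖z i‖ + ε : ℝ) : ℂ) := by fun_prop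
    have h1 : ∀ᶠ ε in nhds (0 : ℝ), (fun i => ((‖z i‖ + ε : ℝ) : ℂ)) ∈ complexBall n r :=
      hcont.continuousAt.eventually ((isOpen_complexBall n r).mem_nhds h0)
    obtain ⟨ε, hε, hε0⟩ := ((h1.filter_mono nhdsWithin_le_nhds).and
      (self_mem_nhdsWithin (s := Set.Ioi (0 : ℝ)))).exists
    have hε0 : 0 < ε := hε0
    exact ⟨fun i => ‖z i‖ + ε, fun i => by positivity, fun i => by simpa using hε0, hε⟩
  have hbdd : ∀ R : Fin n → ℝ, (∀ i, 0 < R i) → (fun i => (R i : ℂ)) ∈ complexBall n r →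
      ∃ M, ∀ w : Fin n → ℂ, (∀ i, ‖w i‖ ≤ R i) → ‖F w‖ ≤ M := by
    intro R hR hRr
    have hc : IsCompact (Set.univ.pi fun i : Fin n => Metric.closedBall (0 : ℂ) (R i)) :=
      isCompact_univ_pi fun _ => isCompact_closedBall _ _
    obtain ⟨M, hM⟩ := hc.exists_bound_of_continuousOn (hF.continuousOn.mono fun w hw =>
      mem_complexBall_of_norm_le hRr fun i => by
        simpa [abs_of_pos (hR i)] using hw i (Set.mem_univ i))
    exact ⟨M, fun w hw => hM w fun i _ => by simpa using hw i⟩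
  obtain ⟨R₀, hR₀, -, hRr₀⟩ := hrad 0 (zero_mem_complexBall n hr)
  obtain ⟨M₀, hM₀⟩ := hbdd R₀ hR₀ hRr₀
  obtain ⟨c, -, hcs⟩ := exists_mvPowerSeries_polydisc hF hR₀ hRr₀ hM₀
  -- The expansions on two polydiscs agree on their intersection, hence have equal coefficients.
  have huniq : ∀ (R : Fin n → ℝ) (M : ℝ), (∀ i, 0 < R i) →
      (fun i => (R i : ℂ)) ∈ complexBall n r →
      (∀ w : Fin n → ℂ, (∀ i, ‖w i‖ ≤ R i) → ‖F w‖ ≤ M) →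
      (∀ k : Fin n →₀ ℕ, ‖MvPowerSeries.coeff k c‖ * ∏ i, R i ^ k i ≤ M) ∧
      ∀ z : Fin n → ℂ, (∀ i, ‖z i‖ < R i) →
        HasSum (fun k : Fin n →₀ ℕ => MvPowerSeries.coeff k c * ∏ i, z i ^ k i) (F z) := by
    intro R M hR hRr hM
    obtain ⟨d, hdM, hds⟩ := exists_mvPowerSeries_polydisc hF hR hRr hM
    obtain rfl : c = d := mvPowerSeries_ext_of_hasSum (R := fun i => min (R₀ i) (R i))
      (fun i => lt_min (hR₀ i) (hR i))
      (fun z hz => hcs z fun i => (hz i).trans_le (min_le_left _ _))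
      (fun z hz => hds z fun i => (hz i).trans_le (min_le_right _ _))
    exact ⟨hdM, hds⟩
  refine ⟨c, fun R M hR hRr hM => (huniq R M hR hRr hM).1, fun z hz => ?_⟩
  obtain ⟨R, hR, hzR, hRr⟩ := hrad z hz
  obtain ⟨M, hM⟩ := hbdd R hR hRr
  exact (huniq R M hR hRr hM).2 z hzR

/-! ### Summation of series -/

/-- Term-by-term differentiation is justified by the Schwarz lemma: the derivative of a term at a
point is bounded by the supremum of the term on a ball of fixed radius about that point. -/
theorem differentiableOn_tsum_ballSeries {n : ℕ} {r : ℝ≥0∞} (c : ballSeries n r) :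
    DifferentiableOn ℂ (fun z : Fin n → ℂ =>
      ∑' k : Fin n →₀ ℕ, MvPowerSeries.coeff k c.1 * ∏ i, z i ^ k i) (complexBall n r) := by
  intro z hz
  obtain ⟨ρ, hρ⟩ := exists_radius_of_mem_complexBall hz
  have hopen : IsOpen {w : Fin n → ℂ | ∑ i, ‖w i‖ ^ 2 < ρ.1 ^ 2} :=
    isOpen_lt (by fun_prop) continuous_const
  obtain ⟨δ, hδ, hball⟩ := Metric.isOpen_iff.1 hopen z hρ
  have hdiff : ∀ k : Fin n →₀ ℕ, Differentiable ℂ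
      (fun z : Fin n → ℂ => MvPowerSeries.coeff k c.1 * ∏ i, z i ^ k i) := by
    intro k
    fun_prop
  have hle : ∀ (k : Fin n →₀ ℕ) (w : Fin n → ℂ), w ∈ Metric.ball z δ →
      ‖MvPowerSeries.coeff k c.1 * ∏ i, w i ^ k i‖ ≤ ballTerm ρ.1 c.1 k := fun k w hw =>
    norm_term_le_ballTerm ρ.2.1.le (le_of_lt (hball hw)) c.1 k
  have hmain := hasFDerivAt_tsum_of_isPreconnected (𝕜 := ℂ)
    (f := fun (k : Fin n →₀ ℕ) (z : Fin n → ℂ) => MvPowerSeries.coeff k c.1 * ∏ i, z i ^ k i)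
    (f' := fun k => fderiv ℂ
      (fun z : Fin n → ℂ => MvPowerSeries.coeff k c.1 * ∏ i, z i ^ k i))
    (u := fun k => 2 * ballTerm ρ.1 c.1 k / (δ / 2)) (s := Metric.ball z (δ / 2))
    (x₀ := z) (x := z)
    (((c.2 ρ).mul_left 2).div_const _) Metric.isOpen_ball (convex_ball _ _).isPreconnected
    (fun k w _ => (hdiff k w).hasFDerivAt)
    (fun k w hw => by
      have hsub : Metric.ball w (δ / 2) ⊆ Metric.ball z δ :=
        Metric.ball_subset_ball' (by rw [Metric.mem_ball] at hw; linarith)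
      refine Complex.norm_fderiv_le_div_of_mapsTo_ball (hdiff k).differentiableOn
        (fun v hv => ?_) (half_pos hδ)
      rw [mem_closedBall_iff_norm]
      refine (norm_sub_le _ _).trans ?_
      rw [two_mul]
      exact add_le_add (hle k v (hsub hv))
        (hle k w (hsub (Metric.mem_ball_self (half_pos hδ)))))
    (Metric.mem_ball_self (half_pos hδ))
    (Summable.of_norm_bounded (c.2 ρ) fun k => hle k z (Metric.mem_ball_self hδ))
    (Metric.mem_ball_self (half_pos hδ))
  exact hmain.differentiableAt.differentiableWithinAt

theorem hasSum_ballSeries {n : ℕ} {r : ℝ≥0∞} (c : ballSeries n r) {z : Fin n → ℂ}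
    (hz : z ∈ complexBall n r) :
    HasSum (fun k : Fin n →₀ ℕ => MvPowerSeries.coeff k c.1 * ∏ i, z i ^ k i)
      (∑' k : Fin n →₀ ℕ, MvPowerSeries.coeff k c.1 * ∏ i, z i ^ k i) := by
  obtain ⟨ρ, hρ⟩ := exists_radius_of_mem_complexBall hz
  exact (Summable.of_norm_bounded (c.2 ρ) fun k =>
    norm_term_le_ballTerm ρ.2.1.le hρ.le c.1 k).hasSum

/-- The linear map taking a power series in `ballSeries n r` to its sum on the ball. -/
noncomputable def ballSeriesSum (n : ℕ) (r : ℝ≥0∞) :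
    ballSeries n r →ₗ[ℂ] holomorphicAlgebra (complexBall n r) where
  toFun c := ⟨⟨fun z => ∑' k : Fin n →₀ ℕ, MvPowerSeries.coeff k c.1 * ∏ i, z.1 i ^ k i,
      (differentiableOn_tsum_ballSeries c).continuousOn.domRestrict⟩,
    _, differentiableOn_tsum_ballSeries c, fun _ => rfl⟩
  map_add' c d := by
    ext z
    refine (hasSum_ballSeries (c + d) z.2).unique ?_
    refine ((hasSum_ballSeries c z.2).add (hasSum_ballSeries d z.2)).congr_fun fun k => ?_
    simp [add_mul]
  map_smul' a c := by
    ext z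
    refine (hasSum_ballSeries (a • c) z.2).unique ?_
    refine ((hasSum_ballSeries c z.2).mul_left a).congr_fun fun k => ?_
    simp [mul_assoc]

theorem hasSum_ballSeriesSum {n : ℕ} {r : ℝ≥0∞} (c : ballSeries n r) (z : complexBall n r) :
    HasSum (fun k : Fin n →₀ ℕ => MvPowerSeries.coeff k c.1 * ∏ i, z.1 i ^ k i)
      ((ballSeriesSum n r c : C(complexBall n r, ℂ)) z) :=
  hasSum_ballSeries c z.2

theorem exists_polydisc_subset_complexBall (n : ℕ) {r : ℝ≥0∞} (hr : 0 < r) :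
    ∃ ε : ℝ, 0 < ε ∧ ∀ z : Fin n → ℂ, (∀ i, ‖z i‖ < ε) → z ∈ complexBall n r := by
  obtain ⟨ε, hε, h⟩ := Metric.isOpen_iff.1 (isOpen_complexBall n r) 0 (zero_mem_complexBall n hr)
  exact ⟨ε, hε, fun z hz => h (by simpa [pi_norm_lt_iff hε] using hz)⟩

theorem ballSeriesSum_injective (n : ℕ) {r : ℝ≥0∞} (hr : 0 < r) :
    Function.Injective (ballSeriesSum n r) := by
  intro c d hcd
  obtain ⟨ε, hε, h⟩ := exists_polydisc_subset_complexBall n hr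
  refine Subtype.ext (mvPowerSeries_ext_of_hasSum (R := fun _ => ε) (fun _ => hε)
    (fun z hz => hasSum_ballSeries c (h z hz)) fun z hz => ?_)
  have := hasSum_ballSeriesSum d ⟨z, h z hz⟩
  rw [← hcd] at this
  exact this

/-- Every holomorphic function on the ball is the sum of a series in `ballSeries n r`, whose norm
of radius `ρ` is bounded by the supremum of the function on any larger ball. -/
theorem exists_ballSeriesSum_eq {n : ℕ} {r : ℝ≥0∞} (hr : 0 < r)
    (f : holomorphicAlgebra (complexBall n r)) :
    ∃ c : ballSeries n r, ballSeriesSum n r c = f ∧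
      ∀ (ρ ρ' : SmallerRadius r) (M : ℝ), ρ.1 < ρ'.1 →
        (∀ z : complexBall n r, ∑ i, ‖z.1 i‖ ^ 2 ≤ ρ'.1 ^ 2 → ‖f.1 z‖ ≤ M) →
        ballSeriesNorm n r ρ c ≤
          M * Real.exp n * ∑' k : Fin n →₀ ℕ, ∏ i, (((k i : ℝ) + 1) * (ρ.1 / ρ'.1) ^ k i) := by
  obtain ⟨F, hF, hfF⟩ := f.2
  obtain ⟨c, hcM, hcs⟩ := exists_taylorSeries hr hF
  have hterm : ∀ (ρ ρ' : SmallerRadius r) (M : ℝ),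
      (∀ z : complexBall n r, ∑ i, ‖z.1 i‖ ^ 2 ≤ ρ'.1 ^ 2 → ‖f.1 z‖ ≤ M) → ∀ k,
      ballTerm ρ.1 c k ≤ M * Real.exp n * ∏ i, (((k i : ℝ) + 1) * (ρ.1 / ρ'.1) ^ k i) := by
    intro ρ ρ' M hM k
    refine ballTerm_le_of_cauchy ρ.2.1 ρ'.2.1 fun R hR hRρ => hcM R M hR ?_ (fun w hw => ?_) k
    · exact mem_complexBall_of_sum_le ρ' (by simpa using hRρ)
    · have hw' : ∑ i, ‖w i‖ ^ 2 ≤ ρ'.1 ^ 2 := by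
        refine le_trans (Finset.sum_le_sum fun i _ => ?_) hRρ
        gcongr
        exact hw i
      rw [← hfF ⟨w, mem_complexBall_of_sum_le ρ' hw'⟩]
      exact hM _ hw'
  have hsum : ∀ (ρ ρ' : SmallerRadius r), ρ.1 < ρ'.1 → Summable fun k : Fin n →₀ ℕ =>
      ∏ i, (((k i : ℝ) + 1) * (ρ.1 / ρ'.1) ^ k i) := fun ρ ρ' h =>
    summable_weight (div_nonneg ρ.2.1.le ρ'.2.1.le) ((div_lt_one ρ'.2.1).2 h)
  have hc : c ∈ ballSeries n r := by
    intro ρ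
    obtain ⟨ρ', hρ'⟩ := exists_radius_gt ρ
    obtain ⟨M, hM⟩ := (isCompact_closedBall_complexBall (n := n) ρ').exists_bound_of_continuousOn
      f.1.continuous.continuousOn
    exact Summable.of_nonneg_of_le (ballTerm_nonneg ρ.2.1 c) (hterm ρ ρ' M hM)
      ((hsum ρ ρ' hρ').mul_left _)
  refine ⟨⟨c, hc⟩, ?_, fun ρ ρ' M hρ' hM => ?_⟩
  · ext z
    refine (hasSum_ballSeriesSum ⟨c, hc⟩ z).unique ?_
    rw [hfF z]
    exact hcs z z.2
  · rw [← tsum_mul_left]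
    exact (hc ρ).tsum_le_tsum (hterm ρ ρ' M hM) ((hsum ρ ρ' hρ').mul_left _)

theorem norm_ballSeriesSum_le {n : ℕ} {r : ℝ≥0∞} (c : ballSeries n r) (ρ : SmallerRadius r)
    (z : complexBall n r) (hz : ∑ i, ‖z.1 i‖ ^ 2 ≤ ρ.1 ^ 2) :
    ‖(ballSeriesSum n r c).1 z‖ ≤ ballSeriesNorm n r ρ c :=
  tsum_of_norm_bounded (c.2 ρ).hasSum fun k => norm_term_le_ballTerm ρ.2.1.le hz c.1 k

/-! ### The topological isomorphism -/

theorem continuous_ballSeriesSum (n : ℕ) {r : ℝ≥0∞} (hr : 0 < r) :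
    Continuous (ballSeriesSum n r) := by
  refine continuous_induced_rng.2 ?_
  rw [ContinuousMap.compactOpen_eq_iInf_induced, continuous_iInf_rng]
  intro K
  rw [continuous_iInf_rng]
  intro hK
  rw [continuous_induced_rng]
  have : CompactSpace K := isCompact_iff_compactSpace.1 hK
  obtain ⟨ρ, hρ⟩ := exists_radius_of_isCompact hr hK
  let T : ballSeries n r →ₗ[ℂ] C(K, ℂ) :=
    { toFun := fun c => (ballSeriesSum n r c).1.restrict K
      map_add' := fun c d => by ext z; simp
      map_smul' := fun a c => by ext z; simp }
  have hT : Continuous T := by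
    refine WithSeminorms.continuous_normedSpace_rng _ (ballSeries_withSeminorms n r) T
      ⟨{ρ}, 1, fun c => ?_⟩
    rw [Finset.sup_singleton, one_smul]
    refine (ContinuousMap.norm_le _ (apply_nonneg _ _)).2 fun z => ?_
    exact norm_ballSeriesSum_le c ρ z.1 (hρ z.1 z.2)
  exact hT

theorem mainTheorem8 (n : ℕ) (r : ℝ≥0∞) (hr : 0 < r) :
    ∃ Φ : holomorphicAlgebra (complexBall n r) ≃L[ℂ] ballSeries n r,
      ∀ (f : holomorphicAlgebra (complexBall n r)) (z : complexBall n r),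
        HasSum (fun k : Fin n →₀ ℕ =>
          MvPowerSeries.coeff k (Φ f : MvPowerSeries (Fin n) ℂ) * ∏ i, (z : Fin n → ℂ) i ^ k i)
          ((f : C(complexBall n r, ℂ)) z) := by
  let e : ballSeries n r ≃ₗ[ℂ] holomorphicAlgebra (complexBall n r) :=
    LinearEquiv.ofBijective (ballSeriesSum n r) ⟨ballSeriesSum_injective n hr, fun f =>
      (exists_ballSeriesSum_eq hr f).imp fun _ h => h.1⟩
  have he : ∀ c, e c = ballSeriesSum n r c := fun _ => rfl
  -- The seminorm `‖·‖_ρ` of the Taylor series is at most `C` times the supremum of the function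
  -- on a compact ball `K` of radius `ρ' > ρ`.
  have hsymm : Continuous e.symm := by
    have : IsTopologicalAddGroup (holomorphicAlgebra (complexBall n r)) :=
      inferInstanceAs (IsTopologicalAddGroup
        (holomorphicAlgebra (complexBall n r)).toSubmodule.toAddSubgroup)
    refine (ballSeries_withSeminorms n r).continuous_of_continuous_comp
      (E := holomorphicAlgebra (complexBall n r)) (τ₁₂ := RingHom.id ℂ)
      (e.symm : holomorphicAlgebra (complexBall n r) →ₗ[ℂ] ballSeries n r) fun ρ => ?_
    obtain ⟨ρ', hρ'⟩ := exists_radius_gt ρ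
    set K : Set (complexBall n r) := {z | ∑ i, ‖z.1 i‖ ^ 2 ≤ ρ'.1 ^ 2} with hK
    have : CompactSpace K := isCompact_iff_compactSpace.1 (isCompact_closedBall_complexBall ρ')
    let T : holomorphicAlgebra (complexBall n r) →ₗ[ℂ] C(K, ℂ) :=
      { toFun := fun f => f.1.restrict K
        map_add' := fun f g => by ext z; simp
        map_smul' := fun a f => by ext z; simp }
    have hT : Continuous T :=
      (ContinuousMap.continuous_restrict K).comp continuous_subtype_val
    set C : ℝ := Real.exp n * ∑' k : Fin n →₀ ℕ, ∏ i, (((k i : ℝ) + 1) * (ρ.1 / ρ'.1) ^ k i)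
      with hC
    have hC0 : 0 ≤ C := mul_nonneg (Real.exp_pos _).le (tsum_nonneg fun k =>
      Finset.prod_nonneg fun i _ => mul_nonneg (by positivity)
        (pow_nonneg (div_nonneg ρ.2.1.le ρ'.2.1.le) _))
    let q : Seminorm ℂ (holomorphicAlgebra (complexBall n r)) :=
      C.toNNReal • Seminorm.comp (E := holomorphicAlgebra (complexBall n r))
        (σ₁₂ := RingHom.id ℂ) (normSeminorm ℂ C(K, ℂ)) T
    have hq : Continuous q :=
      (continuous_norm.comp hT).const_smul C.toNNReal
    refine Seminorm.continuous_of_le hq fun f => ?_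
    obtain ⟨c, rfl, hcb⟩ := exists_ballSeriesSum_eq hr f
    have h := hcb ρ ρ' ‖T (ballSeriesSum n r c)‖ hρ' fun z hz =>
      (T (ballSeriesSum n r c)).norm_coe_le_norm ⟨z, hz⟩
    have h1 : e.symm (ballSeriesSum n r c) = c := e.symm_apply_apply c
    change ballSeriesNorm n r ρ (e.symm (ballSeriesSum n r c)) ≤
      (C.toNNReal : ℝ) * ‖T (ballSeriesSum n r c)‖
    rw [h1, Real.coe_toNNReal _ hC0, hC]
    linarith [h]
  refine ⟨{ e.symm with
    continuous_toFun := hsymm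
    continuous_invFun := continuous_ballSeriesSum n hr }, fun f z => ?_⟩
  have h := hasSum_ballSeriesSum (e.symm f) z
  rwa [← he, e.apply_symm_apply] at h
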